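/- Let $G$ be a finite connected simple graph on $n$ vertices. A block of $G$ is a maximal connected subgraph having no cut vertex of its own. The block tree $T$ of $G$ has as its vertices the cut vertices and the blocks of $G$, a cut vertex $v$ being adjacent to a block $B$ exactly when $v\in B$ (and no other pairs being adjacent). It is weighted by $w(v)=1$ for a cut vertex $v$, and by letting $w(B)$ be the number of vertices of $B$ that are not cut vertices of $G$, for a block $B$; the weight of a set of vertices (or of a subtree) is the sum of the weights of its vertices. For a vertex $x$ of $T$ let $\mathrm{hs}(x)$ be the maximum weight of a connected component of $T-x$ (and $0$ if $x$ is the only vertex of $T$). A centroid of $T$ is a vertex minimizing $\mathrm{hs}$; a central centroid is a center (vertex of minimum eccentricity) of the path formed by the centroids of $T$. Then exactly one of the following holds. 1. $T$ has exactly one centroid $c$, and $\mathrm{hs}(c)<\frac n2$. 2. $T$ has exactly two centroids $v$ and $B$, where $B$ is a block of $G$ and $v\in B$ is a cut vertex of $G$, and the removal of the edge $vB$ partitions $T$ into two subtrees $T_1,T_2$ of weight $\frac n2$ each. Moreover, every proper subtree of $T_1$ and every proper subtree of $T_2$ has weight at most $\frac n2-1$. 3. $T$ contains a block vertex $B$ of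 weight zero which is the unique central centroid of $T$ and whose removal partitions $T$ into exactly two subtrees, each of weight $\frac n2$; moreover the block $B$ is a $K_2$. -/

import Mathlib

namespace BlockTree

section WeightedTree

variable {W : Type*}

/-- The weight `w(U)` of a set `U` of vertices (all vertex types used here are finite). -/
noncomputable def setWeight (w : W → ℕ) (U : Set W) : ℕ := ∑ᶠ x ∈ U, w x

/-- The vertex set, as a set of vertices of `T`, of a connected component of `T - v`,
i.e. of a subtree of `v` in the tree `T`. -/
def subtreeVerts (T : SimpleGraph W) (v : W)
    (C : (T.induce ({v}ᶜ : Set W)).ConnectedComponent) : Set W :=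
  Subtype.val '' C.supp

/-- The heaviest subtree weight of `v` in `(T, w)`; it is `0` if `v` is the only vertex. -/
noncomputable def hs (T : SimpleGraph W) (w : W → ℕ) (v : W) : ℕ :=
  ⨆ C : (T.induce ({v}ᶜ : Set W)).ConnectedComponent, setWeight w (subtreeVerts T v C)

/-- The set of centroids of `(T, w)`: the vertices of minimum heaviest subtree weight. -/
def centroids (T : SimpleGraph W) (w : W → ℕ) : Set W :=
  {c | ∀ x, hs T w c ≤ hs T w x}

/-- `c` is a central centroid: the centroids are exactly the vertices of a path `P` of `T`,
and `c` is a center (vertex of minimum eccentricity) of the path graph `P`. -/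
def IsCentralCentroid (T : SimpleGraph W) (w : W → ℕ) (c : W) : Prop :=
  ∃ (a b : W) (P : T.Walk a b), P.IsPath ∧ P.toSubgraph.verts = centroids T w ∧
    ∃ h : c ∈ P.toSubgraph.verts, (⟨c, h⟩ : P.toSubgraph.verts) ∈ P.toSubgraph.coe.center

/-- Every proper subtree of the part of the tree `T` with vertex set `U` has weight at most `r`.
Subtrees of a tree are its nonempty connected induced subgraphs. -/
def ProperSubtreesWeighAtMost (T : SimpleGraph W) (w : W → ℕ) (U : Set W) (r : ℚ) : Prop :=
  ∀ S : Set W, S ⊂ U → (T.induce S).Connected → (setWeight w S : ℚ) ≤ r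

/-- The removal of the edge `xy` partitions `T` into exactly two components, the one of `x` and
the one of `y`; each has weight `n/2`, and their proper subtrees weigh at most `n/2 - 1`. -/
def EdgeHalves (T : SimpleGraph W) (w : W → ℕ) (n : ℕ) (x y : W) : Prop :=
  ∃ C₁ C₂ : (T.deleteEdges {s(x, y)}).ConnectedComponent,
    x ∈ C₁.supp ∧ y ∈ C₂.supp ∧ C₁ ≠ C₂ ∧ (∀ C, C = C₁ ∨ C = C₂) ∧
    (setWeight w C₁.supp : ℚ) = n / 2 ∧ (setWeight w C₂.supp : ℚ) = n / 2 ∧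
    ProperSubtreesWeighAtMost T w C₁.supp ((n : ℚ) / 2 - 1) ∧
    ProperSubtreesWeighAtMost T w C₂.supp ((n : ℚ) / 2 - 1)

/-- The removal of the vertex `x` partitions `T` into exactly two subtrees of weight `n/2`. -/
def VertexHalves (T : SimpleGraph W) (w : W → ℕ) (n : ℕ) (x : W) : Prop :=
  ∃ C₁ C₂ : (T.induce ({x}ᶜ : Set W)).ConnectedComponent,
    C₁ ≠ C₂ ∧ (∀ C, C = C₁ ∨ C = C₂) ∧
    (setWeight w (subtreeVerts T x C₁) : ℚ) = n / 2 ∧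
    (setWeight w (subtreeVerts T x C₂) : ℚ) = n / 2

end WeightedTree

section Blocks

variable {V : Type*}

/-- `v` is a cut vertex of `G`: it separates two other vertices of the same component. -/
def IsCutVertex (G : SimpleGraph V) (v : V) : Prop :=
  ∃ a b : ({v}ᶜ : Set V), G.Reachable a.1 b.1 ∧ ¬ (G.induce ({v}ᶜ : Set V)).Reachable a b

/-- `B` is the vertex set of a block of `G`: a maximal connected subgraph without a cut vertex of
its own. Such a subgraph is induced, so that it is determined by its vertex set. -/
def IsBlock (G : SimpleGraph V) (B : Set V) : Prop :=
  Maximal (fun S : Set V => (G.induce S).Connected ∧ ∀ x : S, ¬ IsCutVertex (G.induce S) x) B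

/-- The vertices of the block tree: the cut vertices and the blocks of `G`. -/
abbrev Node (G : SimpleGraph V) : Type _ :=
  {v : V // IsCutVertex G v} ⊕ {B : Set V // IsBlock G B}

/-- Adjacency in the block tree: a cut vertex and a block that contains it. -/
def nodeAdj (G : SimpleGraph V) : Node G → Node G → Prop
  | .inl v, .inr B => v.1 ∈ B.1
  | .inr B, .inl v => v.1 ∈ B.1
  | .inl _, .inl _ => False
  | .inr _, .inr _ => False

/-- The block tree of `G`. -/
def blockTree (G : SimpleGraph V) : SimpleGraph (Node G) where
  Adj := nodeAdj G
  symm := ⟨by rintro (_ | _) (_ | _) h <;> exact h⟩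
  loopless := ⟨by rintro (_ | _) h <;> exact h⟩

/-- The weights of the block tree: a cut vertex weighs `1`, a block weighs the number of its
vertices that are not cut vertices of `G`. -/
noncomputable def weight (G : SimpleGraph V) : Node G → ℕ
  | .inl _ => 1
  | .inr B => {x : V | x ∈ B.1 ∧ ¬ IsCutVertex G x}.ncard

/-- There is exactly one centroid, and its heaviest subtree weight is less than `n/2`. -/
def OneCentroid (G : SimpleGraph V) (n : ℕ) : Prop :=
  ∃ c : Node G, centroids (blockTree G) (weight G) = {c} ∧
    (hs (blockTree G) (weight G) c : ℚ) < n / 2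

/-- There are exactly two centroids, a cut vertex `v` and a block `B` with `v ∈ B`, and the edge
`vB` splits the block tree into two halves. -/
def TwoCentroids (G : SimpleGraph V) (n : ℕ) : Prop :=
  ∃ (v : {v : V // IsCutVertex G v}) (B : {B : Set V // IsBlock G B}), v.1 ∈ B.1 ∧
    centroids (blockTree G) (weight G) = {.inl v, .inr B} ∧
    EdgeHalves (blockTree G) (weight G) n (.inl v) (.inr B)

/-- A block `B` of weight zero is the unique central centroid, its removal splits the block tree
into two halves, and `B` is a `K₂`. -/
def ZeroWeightCentralBlock (G : SimpleGraph V) (n : ℕ) : Prop :=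
  ∃ B : {B : Set V // IsBlock G B}, weight G (.inr B) = 0 ∧
    (∀ x : Node G, IsCentralCentroid (blockTree G) (weight G) x ↔ x = .inr B) ∧
    VertexHalves (blockTree G) (weight G) n (.inr B) ∧
    Nonempty (G.induce B.1 ≃g (⊤ : SimpleGraph (Fin 2)))

end Blocks

end BlockTree

/-! The block tree is a tree of total weight `n`, and the rest is an argument about weighted trees
whose weight-zero vertices are under control. For a vertex `x`, `branch T x y` is the component of
`T - x` containing `y`. For `x ≠ y` the sets `branch T x y` and `branch T y x` cover `T`, and they
are complementary when `xy` is an edge.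

Moving repeatedly into a branch heavier than `n/2` cannot go on forever, so some `c` has `hs c ≤
n/2` (`exists_two_mul_hs_le`). If the inequality is strict, the covering gives `hs x > n/2` for
every other `x`, and `c` is the only centroid. If equality holds, some edge at `c` halves the
weight. Both its ends are then centroids, every centroid has `hs = n/2`, and the edge joins a cut
vertex `v` to a block `B`.

A further centroid can lie only beyond an end of weight zero (`weight_eq_zero_of_centroid`), hence
beyond `B`, never beyond `v`. If there is none, the second alternative holds. Otherwise `B` consists
of cut vertices and has a second branch of weight `n/2` (`half_of_centroid`). The two halves leave
no weight for a third neighbour, so `B = {v, u}` is a `K₂`, and since `u` has weight one the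
centroids are exactly `v`, `B`, `u`.

That the block tree is a tree rests on two facts: distinct blocks sharing a vertex are separated by
it, and a vertex that is not a cut vertex lies in only one block. -/

namespace BlockTree

/-! ### Walks confined to a set of vertices -/

section Joined

variable {V : Type*} {G : SimpleGraph V} {S S' : Set V} {a b c x y z : V}

/-- `a` and `b` are joined by a walk of `G` all of whose vertices lie in `S`. -/
def Joined (G : SimpleGraph V) (S : Set V) (a b : V) : Prop :=
  ∃ p : G.Walk a b, ∀ z ∈ p.support, z ∈ S

theorem Joined.refl (h : a ∈ S) : Joined G S a a :=
  ⟨.nil, by simpa using h⟩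

theorem Joined.symm (h : Joined G S a b) : Joined G S b a := by
  obtain ⟨p, hp⟩ := h
  exact ⟨p.reverse, by simpa using hp⟩

theorem Joined.trans (h : Joined G S a b) (h' : Joined G S b c) : Joined G S a c := by
  obtain ⟨p, hp⟩ := h
  obtain ⟨q, hq⟩ := h'
  refine ⟨p.append q, fun z hz => ?_⟩
  rw [SimpleGraph.Walk.mem_support_append_iff] at hz
  exact hz.elim (hp z) (hq z)

theorem Joined.mono (hS : S ⊆ S') (h : Joined G S a b) : Joined G S' a b := by
  obtain ⟨p, hp⟩ := h
  exact ⟨p, fun z hz => hS (hp z hz)⟩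

theorem Joined.left_mem (h : Joined G S a b) : a ∈ S := by
  obtain ⟨p, hp⟩ := h
  exact hp _ p.start_mem_support

theorem Joined.right_mem (h : Joined G S a b) : b ∈ S := h.symm.left_mem

theorem Joined.of_adj (h : G.Adj a b) (ha : a ∈ S) (hb : b ∈ S) : Joined G S a b :=
  ⟨h.toWalk, by simp [ha, hb]⟩

theorem Joined.exists_adj (h : Joined G S a b) (hab : a ≠ b) : ∃ c ∈ S, G.Adj a c := by
  obtain ⟨p, hp⟩ := h
  cases p with
  | nil => exact absurd rfl hab
  | cons hac q => exact ⟨_, hp _ (by simp), hac⟩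

theorem joined_iff_reachable_induce (ha : a ∈ S) (hb : b ∈ S) :
    Joined G S a b ↔ (G.induce S).Reachable ⟨a, ha⟩ ⟨b, hb⟩ := by
  constructor
  · rintro ⟨p, hp⟩
    exact ⟨p.induce S hp⟩
  · rintro ⟨p⟩
    refine ⟨p.map (SimpleGraph.Embedding.induce S).toHom, fun z hz => ?_⟩
    have hz' := hz
    erw [SimpleGraph.Walk.support_map, List.mem_map] at hz'
    obtain ⟨y, -, rfl⟩ := hz'
    exact y.2

theorem joined_univ_iff : Joined G Set.univ a b ↔ G.Reachable a b :=
  ⟨fun ⟨p, _⟩ => ⟨p⟩, fun ⟨p⟩ => ⟨p, fun _ _ => trivial⟩⟩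

/-- A vertex of a path other than `x` reaches one of the ends of the path without meeting `x`. -/
theorem joined_end_of_isPath {p : G.Walk a b} (hp : p.IsPath) (hy : y ∈ p.support) (hyx : y ≠ x) :
    Joined G ({z | z ∈ p.support} \ {x}) y a ∨ Joined G ({z | z ∈ p.support} \ {x}) y b := by
  classical
  by_cases h : x ∈ (p.takeUntil y hy).support
  · right
    refine ⟨p.dropUntil y hy, fun z hz => ⟨p.support_dropUntil_subset_support hy hz, ?_⟩⟩
    rintro rfl
    have hn := hp.support_nodup
    rw [← p.take_spec hy, SimpleGraph.Walk.support_append, List.nodup_append] at hn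
    have hz' : z ∈ (p.dropUntil y hy).support.tail := by
      rw [SimpleGraph.Walk.mem_support_iff] at hz
      exact hz.resolve_left (Ne.symm hyx)
    exact hn.2.2 _ h _ hz' rfl
  · left
    refine Joined.symm ⟨p.takeUntil y hy, fun z hz =>
      ⟨p.support_takeUntil_subset_support hy hz, ?_⟩⟩
    rintro rfl
    exact h hz

end Joined

/-! ### Branches of a tree at a vertex -/

section WeightedTree

variable {W : Type*} {T : SimpleGraph W} {w : W → ℕ} {x y z u c : W} {n : ℕ}

theorem setWeight_union [Finite W] {A B : Set W} (h : Disjoint A B) :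
    setWeight w (A ∪ B) = setWeight w A + setWeight w B :=
  finsum_mem_union h A.toFinite B.toFinite

theorem setWeight_mono [Finite W] {A B : Set W} (h : A ⊆ B) : setWeight w A ≤ setWeight w B := by
  rw [← Set.union_sdiff_cancel h, setWeight_union Set.disjoint_sdiff_right]
  exact Nat.le_add_right _ _

theorem setWeight_singleton : setWeight w {x} = w x := finsum_mem_singleton

/-- The vertices of the component of `T - x` that contains `y`. -/
def branch (T : SimpleGraph W) (x y : W) : Set W := {z | Joined T {x}ᶜ y z}

theorem self_mem_branch (h : y ≠ x) : y ∈ branch T x y := Joined.refl h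

theorem notMem_branch : x ∉ branch T x y := fun h => h.right_mem rfl

theorem mem_branch_comm (h : z ∈ branch T x y) : y ∈ branch T x z := Joined.symm h

theorem branch_eq_of_mem (h : z ∈ branch T x y) : branch T x z = branch T x y :=
  Set.ext fun _ => ⟨fun h' => Joined.trans h h', fun h' => (Joined.symm h).trans h'⟩

theorem disjoint_branch (h : z ∉ branch T x y) : Disjoint (branch T x z) (branch T x y) :=
  Set.disjoint_left.2 fun _ h₁ h₂ => h (Joined.trans h₂ (Joined.symm h₁))

theorem subtreeVerts_mk (h : y ≠ x) :
    subtreeVerts T x ((T.induce ({x}ᶜ : Set W)).connectedComponentMk ⟨y, h⟩) = branch T x y := by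
  ext z
  simp only [subtreeVerts, Set.mem_image, SimpleGraph.ConnectedComponent.mem_supp_iff,
    SimpleGraph.ConnectedComponent.eq]
  constructor
  · rintro ⟨s, hs, rfl⟩
    exact (joined_iff_reachable_induce h s.2).2 hs.symm
  · intro hz
    exact ⟨⟨z, hz.right_mem⟩, ((joined_iff_reachable_induce h hz.right_mem).1 hz).symm, rfl⟩

theorem exists_subtreeVerts_eq (C : (T.induce ({x}ᶜ : Set W)).ConnectedComponent) :
    ∃ (y : W) (h : y ≠ x), C = (T.induce ({x}ᶜ : Set W)).connectedComponentMk ⟨y, h⟩ := by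
  induction C using SimpleGraph.ConnectedComponent.ind with
  | _ s => exact ⟨s.1, s.2, rfl⟩

theorem setWeight_branch_le_hs [Finite W] (h : y ≠ x) :
    setWeight w (branch T x y) ≤ hs T w x := by
  rw [← subtreeVerts_mk h]
  exact le_ciSup (f := fun C => setWeight w (subtreeVerts T x C)) (Set.finite_range _).bddAbove _

theorem hs_le (h : ∀ y, y ≠ x → setWeight w (branch T x y) ≤ n) : hs T w x ≤ n := by
  rw [hs]
  refine ciSup_le' fun C => ?_
  obtain ⟨y, hy, rfl⟩ := exists_subtreeVerts_eq C
  rw [subtreeVerts_mk hy]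
  exact h y hy

theorem exists_adj_mem_branch (hT : T.Connected) (h : y ≠ x) :
    ∃ u, T.Adj x u ∧ u ∈ branch T x y := by
  obtain ⟨p, hp⟩ := hT.exists_isPath x y
  cases p with
  | nil => exact absurd rfl h
  | @cons _ u _ hxu q =>
    rw [SimpleGraph.Walk.cons_isPath_iff] at hp
    exact ⟨u, hxu, Joined.symm ⟨q, fun z hz => by rintro rfl; exact hp.2 hz⟩⟩

/-- The supremum is attained. Positivity excludes the one-vertex tree, where `hs` is the default
value `0` of an empty supremum. -/
theorem exists_branch_eq_hs [Finite W] (hT : T.Connected) (h : 0 < hs T w x) :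
    ∃ y, T.Adj x y ∧ setWeight w (branch T x y) = hs T w x := by
  by_contra! hne
  have : hs T w x ≤ hs T w x - 1 := hs_le fun y hy => by
    obtain ⟨u, hu, huy⟩ := exists_adj_mem_branch hT hy
    have h₁ := hne u hu
    have h₂ := setWeight_branch_le_hs (T := T) (w := w) hu.ne'
    rw [branch_eq_of_mem huy] at h₁ h₂
    omega
  omega

/-- A path from `z` to `y` either avoids `x`, or has an initial segment from `z` to `x` that avoids
`y`. Acyclicity plays no role here. -/
theorem branch_union_branch (hT : T.Connected) (h : x ≠ y) :
    branch T x y ∪ branch T y x = Set.univ := by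
  refine Set.eq_univ_of_forall fun z => ?_
  by_cases hzy : z = y
  · subst hzy
    exact Or.inl (self_mem_branch h.symm)
  obtain ⟨p, hp⟩ := hT.exists_isPath z y
  by_cases hx : x ∈ p.support
  · right
    rcases joined_end_of_isPath hp hx h with h' | h'
    · exact h'.mono fun _ h => h.2
    · exact absurd rfl h'.right_mem.2
  · exact Or.inl (Joined.symm ⟨p, fun s hs => by rintro rfl; exact hx hs⟩)

theorem branch_subset_branch (hT : T.Connected) (h : x ≠ y) (hz : z ∉ branch T y x) :
    branch T y z ⊆ branch T x y := fun s hs =>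
  ((branch_union_branch hT h).ge (Set.mem_univ s)).resolve_right
    (Set.disjoint_left.1 (disjoint_branch hz) hs)

theorem reachable_deleteEdges_of_mem_branch (h : z ∈ branch T x y) :
    (T.deleteEdges {s(x, u)}).Reachable y z := by
  obtain ⟨p, hp⟩ := h
  refine ⟨p.toDeleteEdges _ fun e he => ?_⟩
  rintro rfl
  exact hp x (p.fst_mem_support_of_mem_edges he) rfl

theorem not_reachable_deleteEdges (hT : T.IsAcyclic) (h : T.Adj x y) :
    ¬ (T.deleteEdges {s(x, y)}).Reachable x y :=
  SimpleGraph.isBridge_iff.1 (SimpleGraph.isAcyclic_iff_forall_adj_isBridge.1 hT h)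

theorem disjoint_branch_branch (hT : T.IsAcyclic) (h : T.Adj x y) :
    Disjoint (branch T x y) (branch T y x) := by
  refine Set.disjoint_left.2 fun z h₁ h₂ => not_reachable_deleteEdges hT h ?_
  have r₁ := reachable_deleteEdges_of_mem_branch (u := y) h₁
  have r₂ := reachable_deleteEdges_of_mem_branch (u := x) h₂
  rw [Sym2.eq_swap] at r₂
  exact r₂.trans r₁.symm

/-- Distinct neighbours of `x` lie in distinct branches: the edge `zx` avoids `y`, so it puts `z` on
the side of `x` with respect to the bridge `xy`. -/
theorem eq_of_adj_of_mem_branch (hT : T.IsAcyclic) (hy : T.Adj x y) (hz : T.Adj x z)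
    (h : z ∈ branch T x y) : z = y := by
  by_contra hne
  exact Set.disjoint_left.1 (disjoint_branch_branch hT hy) h
    (Joined.of_adj hz hy.ne hne)

theorem supp_deleteEdges_eq_branch (hT : T.IsTree) (h : T.Adj x y) :
    ((T.deleteEdges {s(x, y)}).connectedComponentMk y).supp = branch T x y := by
  ext z
  rw [SimpleGraph.ConnectedComponent.mem_supp_iff, SimpleGraph.ConnectedComponent.eq]
  constructor
  · intro hz
    refine ((branch_union_branch hT.connected h.ne).ge (Set.mem_univ z)).resolve_right fun h' => ?_
    have r := reachable_deleteEdges_of_mem_branch (u := x) h'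
    rw [Sym2.eq_swap] at r
    exact not_reachable_deleteEdges hT.isAcyclic h (r.trans hz)
  · exact fun hz => (reachable_deleteEdges_of_mem_branch hz).symm

/-! ### Centroids and edges that halve the weight -/

section Halves

variable [Finite W]

theorem le_setWeight_branch_add (hT : T.IsTree) (hw : setWeight w Set.univ = n)
    (h : x ≠ y) :
    n ≤ setWeight w (branch T x y) + setWeight w (branch T y x) := by
  rw [← hw, ← branch_union_branch hT.connected h, ← Set.union_sdiff_self,
    setWeight_union Set.disjoint_sdiff_right]
  exact Nat.add_le_add_left (setWeight_mono Set.sdiff_subset) _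

theorem setWeight_branch_add (hT : T.IsTree) (hw : setWeight w Set.univ = n)
    (h : T.Adj x y) :
    setWeight w (branch T x y) + setWeight w (branch T y x) = n := by
  rw [← hw, ← branch_union_branch hT.connected h.ne,
    setWeight_union (disjoint_branch_branch hT.isAcyclic h)]

/-- Otherwise each `x` has a neighbour `f x` whose branch is heavier than `n/2`. Choose `c` whose
heavy branch has the fewest vertices. The heavy branch at `f c` cannot point back to `c`, as both
sides of one edge would exceed `n/2`, so it is strictly smaller. -/
theorem exists_two_mul_hs_le (hT : T.IsTree) (hw : setWeight w Set.univ = n)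
    : ∃ c, 2 * hs T w c ≤ n := by
  by_contra! hlt
  have hex : ∀ x, ∃ y, T.Adj x y ∧ n < 2 * setWeight w (branch T x y) := fun x => by
    obtain ⟨y, hy, hxy⟩ := exists_branch_eq_hs (w := w) hT.connected (x := x)
      (by have := hlt x; omega)
    exact ⟨y, hy, hxy ▸ hlt x⟩
  choose f hf hfn using hex
  have := hT.connected.nonempty
  obtain ⟨c, hc⟩ := Finite.exists_min fun x => (branch T x (f x)).ncard
  have hcn := hfn c
  have hcn' := hfn (f c)
  have hsum := setWeight_branch_add hT hw (hf c)
  have hout : f (f c) ∉ branch T (f c) c := fun h => by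
    rw [branch_eq_of_mem h] at hcn'
    omega
  have hsub := branch_subset_branch hT.connected (hf c).ne hout
  have hss : branch T (f c) (f (f c)) ⊂ branch T c (f c) :=
    ⟨hsub, fun h => notMem_branch (h (self_mem_branch (hf c).ne'))⟩
  exact absurd (hc (f c)) (not_le.2 (Set.ncard_lt_ncard hss))

theorem two_mul_hs_le_of_mem_centroids (hT : T.IsTree) (hw : setWeight w Set.univ = n)
    (hc : c ∈ centroids T w) : 2 * hs T w c ≤ n := by
  obtain ⟨d, hd⟩ := exists_two_mul_hs_le hT hw
  have := hc d
  omega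

theorem centroids_eq_singleton (hT : T.IsTree) (hw : setWeight w Set.univ = n)
    (hc : 2 * hs T w c < n) : centroids T w = {c} := by
  have hlt : ∀ x, x ≠ c → hs T w c < hs T w x := fun x hx => by
    have h₁ := le_setWeight_branch_add hT hw hx
    have h₂ := setWeight_branch_le_hs (T := T) (w := w) hx
    have h₃ := setWeight_branch_le_hs (T := T) (w := w) hx.symm
    omega
  refine Set.eq_singleton_iff_unique_mem.2 ⟨fun x => ?_, fun x hx => ?_⟩
  · by_cases hx : x = c
    · rw [hx]
    · exact (hlt x hx).le
  · by_contra hne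
    exact absurd (hx c) (not_le.2 (hlt x hne))

/-- If some edge halves the total weight, then every vertex has a subtree weighing at least one
half. -/
theorem le_two_mul_hs (hT : T.IsTree) (hw : setWeight w Set.univ = n)
    (hxy : T.Adj x y) (hx : 2 * setWeight w (branch T x y) = n) (z : W) :
    n ≤ 2 * hs T w z := by
  have hsum := setWeight_branch_add hT hw hxy
  by_cases hzx : z = x
  · subst hzx
    have := setWeight_branch_le_hs (T := T) (w := w) hxy.ne'
    omega
  by_cases hzy : z = y
  · subst hzy
    have := setWeight_branch_le_hs (T := T) (w := w) hxy.ne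
    omega
  -- The half on the side of the edge away from `z` lies in a single branch at `z`.
  rcases (branch_union_branch hT.connected hxy.ne).ge (Set.mem_univ z) with h | h
  · have hin : z ∉ branch T y x :=
      Set.disjoint_left.1 (disjoint_branch_branch hT.isAcyclic hxy) h
    have hsub := branch_subset_branch hT.connected hzy fun h' => hin (mem_branch_comm h')
    have h₁ := setWeight_mono (w := w) hsub
    have h₂ := setWeight_branch_le_hs (T := T) (w := w) (Ne.symm hzy)
    omega
  · have hin : z ∉ branch T x y :=
      Set.disjoint_right.1 (disjoint_branch_branch hT.isAcyclic hxy) h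
    have hsub := branch_subset_branch hT.connected hzx fun h' => hin (mem_branch_comm h')
    have h₁ := setWeight_mono (w := w) hsub
    have h₂ := setWeight_branch_le_hs (T := T) (w := w) (Ne.symm hzx)
    omega

theorem two_mul_hs_eq_of_half (hT : T.IsTree) (hw : setWeight w Set.univ = n)
    (hxy : T.Adj x y) (hx : 2 * setWeight w (branch T x y) = n) :
    2 * hs T w x = n := by
  have hsum := setWeight_branch_add hT hw hxy
  refine le_antisymm ?_ (le_two_mul_hs hT hw hxy hx x)
  have : hs T w x ≤ n / 2 := hs_le fun z hz => by
    by_cases h : z ∈ branch T x y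
    · rw [branch_eq_of_mem h]
      omega
    · have := setWeight_mono (w := w) (branch_subset_branch hT.connected hxy.ne' h)
      omega
  omega

theorem mem_centroids_of_half (hT : T.IsTree) (hw : setWeight w Set.univ = n)
    (hxy : T.Adj x y) (hx : 2 * setWeight w (branch T x y) = n) :
    x ∈ centroids T w := fun z => by
  have h₁ := le_two_mul_hs hT hw hxy hx z
  have h₂ := two_mul_hs_eq_of_half hT hw hxy hx
  omega

theorem half_comm (hT : T.IsTree) (hw : setWeight w Set.univ = n)
    (hxy : T.Adj x y)
    (hx : 2 * setWeight w (branch T x y) = n) : 2 * setWeight w (branch T y x) = n := by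
  have := setWeight_branch_add hT hw hxy
  omega

/-- Beyond an end `y` of a halving edge `xy` there is no centroid unless `y` has weight zero. -/
theorem weight_eq_zero_of_centroid (hT : T.IsTree) (hw : setWeight w Set.univ = n)
    (hxy : T.Adj x y) (hx : 2 * setWeight w (branch T x y) = n)
    (hz : z ∈ centroids T w) (hzb : z ∈ branch T x y) (hzy : z ≠ y) : w y = 0 := by
  have hsum := setWeight_branch_add hT hw hxy
  have hin : z ∉ branch T y x :=
    Set.disjoint_left.1 (disjoint_branch_branch hT.isAcyclic hxy) hzb
  have hsub := branch_subset_branch hT.connected hzy fun h' => hin (mem_branch_comm h')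
  -- Seen from `z`, the branch towards `y` contains both the half behind `y` and `y` itself, so `n/2
  -- + w y ≤ hs z ≤ n/2`.
  have h₁ : setWeight w (branch T y x ∪ {y}) ≤ setWeight w (branch T z y) :=
    setWeight_mono (Set.union_subset hsub (by simpa using self_mem_branch (Ne.symm hzy)))
  rw [setWeight_union (by simpa using notMem_branch), setWeight_singleton] at h₁
  have h₂ := setWeight_branch_le_hs (T := T) (w := w) (Ne.symm hzy)
  have h₃ := two_mul_hs_le_of_mem_centroids hT hw hz
  omega

/-- A centroid beyond an end `y` of a halving edge `xy` lies in a second branch at `y` of half the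
total weight. -/
theorem half_of_centroid (hT : T.IsTree) (hw : setWeight w Set.univ = n)
    (hxy : T.Adj x y) (hx : 2 * setWeight w (branch T x y) = n)
    (hz : z ∈ centroids T w) (hzb : z ∈ branch T x y) (hzy : z ≠ y) :
    2 * setWeight w (branch T y z) = n := by
  have hin : z ∉ branch T y x :=
    Set.disjoint_left.1 (disjoint_branch_branch hT.isAcyclic hxy) hzb
  -- The branch at `y` towards `z` lies within one half, so it weighs at most `n/2`; the opposite
  -- branch at the centroid `z` also weighs at most `n/2`, and the two cover `T`.
  have h₁ := setWeight_mono (w := w) (branch_subset_branch hT.connected hxy.ne hin)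
  have h₂ := setWeight_branch_le_hs (T := T) (w := w) (Ne.symm hzy)
  have h₃ := two_mul_hs_le_of_mem_centroids hT hw hz
  have h₄ := le_setWeight_branch_add hT hw hzy
  omega

end Halves

end WeightedTree

/-! ### Nonseparable sets and blocks -/

section Blocks

variable {V : Type*} {G : SimpleGraph V} {S S' B B' : Set V} {a b c v x y z : V}

theorem joined_induce_iff {a b x : S} :
    Joined (G.induce S) {x}ᶜ a b ↔ Joined G (S \ {x.1}) a.1 b.1 := by
  constructor
  · rintro ⟨p, hp⟩
    refine ⟨p.map (SimpleGraph.Embedding.induce S).toHom, fun z hz => ?_⟩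
    have hz' := hz
    erw [SimpleGraph.Walk.support_map, List.mem_map] at hz'
    obtain ⟨y, hy, rfl⟩ := hz'
    exact ⟨y.2, fun h => hp y hy (Subtype.ext h)⟩
  · rintro ⟨p, hp⟩
    refine ⟨p.induce S fun z hz => (hp z hz).1, fun z hz => ?_⟩
    rw [SimpleGraph.Walk.support_induce, List.mem_attachWith] at hz
    rintro rfl
    exact (hp _ hz).2 rfl

/-- The vertices of `S` are pairwise joined inside `S`. -/
def IsJoinedSet (G : SimpleGraph V) (S : Set V) : Prop := ∀ a ∈ S, ∀ b ∈ S, Joined G S a b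

theorem preconnected_induce_iff : (G.induce S).Preconnected ↔ IsJoinedSet G S :=
  ⟨fun h a ha b hb => (joined_iff_reachable_induce ha hb).2 (h ⟨a, ha⟩ ⟨b, hb⟩),
    fun h a b => (joined_iff_reachable_induce a.2 b.2).1 (h a a.2 b b.2)⟩

theorem IsJoinedSet.extend (hS : IsJoinedSet G S) (hsub : S ⊆ S')
    (h : ∀ y ∈ S', ∃ s ∈ S, Joined G S' y s) : IsJoinedSet G S' := fun a ha b hb => by
  obtain ⟨s, hs, has⟩ := h a ha
  obtain ⟨t, ht, hbt⟩ := h b hb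
  exact (has.trans ((hS s hs t ht).mono hsub)).trans hbt.symm

/-- `S` induces a connected subgraph without cut vertices. -/
def IsNonseparable (G : SimpleGraph V) (S : Set V) : Prop :=
  S.Nonempty ∧ IsJoinedSet G S ∧ ∀ x, IsJoinedSet G (S \ {x})

theorem isNonseparable_iff :
    ((G.induce S).Connected ∧ ∀ x : S, ¬ IsCutVertex (G.induce S) x) ↔ IsNonseparable G S := by
  rw [SimpleGraph.connected_iff, preconnected_induce_iff, Set.nonempty_coe_sort]
  constructor
  · rintro ⟨⟨hS, hne⟩, h⟩
    refine ⟨hne, hS, fun x => ?_⟩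
    by_cases hx : x ∈ S
    · intro a ha b hb
      by_contra hab
      refine h ⟨x, hx⟩ ⟨⟨⟨a, ha.1⟩, fun h => ha.2 (congrArg Subtype.val h)⟩,
        ⟨⟨b, hb.1⟩, fun h => hb.2 (congrArg Subtype.val h)⟩,
        preconnected_induce_iff.2 hS _ _, fun hr => hab ?_⟩
      exact joined_induce_iff.1 ((joined_iff_reachable_induce _ _).2 hr)
    · rwa [Set.sdiff_singleton_eq_self hx]
  · rintro ⟨hne, hS, h⟩
    refine ⟨⟨hS, hne⟩, ?_⟩
    rintro x ⟨a, b, -, hab⟩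
    refine hab ((joined_iff_reachable_induce a.2 b.2).1 (joined_induce_iff.2 ?_))
    exact h x.1 _ ⟨a.1.2, fun h => a.2 (Subtype.ext h)⟩ _ ⟨b.1.2, fun h => b.2 (Subtype.ext h)⟩

theorem isBlock_iff : IsBlock G B ↔ Maximal (IsNonseparable G) B := by
  rw [IsBlock, funext fun S => propext (isNonseparable_iff (G := G) (S := S))]

theorem IsBlock.isNonseparable (h : IsBlock G B) : IsNonseparable G B := (isBlock_iff.1 h).prop

theorem IsBlock.eq_of_subset (h : IsBlock G B) (hS : IsNonseparable G S) (hB : B ⊆ S) : B = S :=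
  (isBlock_iff.1 h).eq_of_subset hS hB

theorem not_isCutVertex_iff (hG : G.Connected) :
    ¬ IsCutVertex G v ↔ ∀ a b, a ≠ v → b ≠ v → Joined G {v}ᶜ a b := by
  constructor
  · intro h a b ha hb
    by_contra hab
    exact h ⟨⟨a, ha⟩, ⟨b, hb⟩, hG.preconnected _ _, fun hr =>
      hab ((joined_iff_reachable_induce _ _).2 hr)⟩
  · rintro h ⟨a, b, -, hab⟩
    exact hab ((joined_iff_reachable_induce _ _).1 (h a b a.2 b.2))

theorem isJoinedSet_of_subsingleton (h : S.Subsingleton) : IsJoinedSet G S := fun a ha b hb => by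
  obtain rfl := h ha hb
  exact Joined.refl ha

theorem isNonseparable_pair (h : G.Adj a b) : IsNonseparable G {a, b} := by
  refine ⟨⟨a, by simp⟩, ?_, fun x => ?_⟩
  · have hab : Joined G {a, b} a b := Joined.of_adj h (by simp) (by simp)
    rintro c (rfl | rfl) d (rfl | rfl)
    exacts [Joined.refl (by simp), hab, hab.symm, Joined.refl (by simp)]
  · by_cases hx : x = a ∨ x = b
    · refine isJoinedSet_of_subsingleton ?_
      rintro c ⟨rfl | rfl, hc⟩ d ⟨rfl | rfl, hd⟩ <;> grind
    · push Not at hx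
      have hab : Joined G ({a, b} \ {x}) a b :=
        Joined.of_adj h ⟨by simp, hx.1.symm⟩ ⟨by simp, hx.2.symm⟩
      rintro c ⟨rfl | rfl, hc⟩ d ⟨rfl | rfl, hd⟩
      exacts [Joined.refl hab.left_mem, hab, hab.symm, Joined.refl hab.right_mem]

theorem IsNonseparable.union (hS : IsNonseparable G S) (hS' : IsNonseparable G S') (hab : a ≠ b)
    (ha : a ∈ S) (ha' : a ∈ S') (hb : b ∈ S) (hb' : b ∈ S') : IsNonseparable G (S ∪ S') := by
  refine ⟨hS.1.inl, hS.2.1.extend Set.subset_union_left ?_, fun x =>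
    (hS.2.2 x).extend (Set.sdiff_subset_sdiff_left Set.subset_union_left) ?_⟩
  · rintro y (hy | hy)
    · exact ⟨y, hy, Joined.refl (.inl hy)⟩
    · exact ⟨a, ha, (hS'.2.1 y hy a ha').mono Set.subset_union_right⟩
  · rintro y ⟨hy | hy, hyx⟩
    · exact ⟨y, ⟨hy, hyx⟩, Joined.refl ⟨.inl hy, hyx⟩⟩
    · have key : ∀ s ∈ S, s ∈ S' → s ≠ x → ∃ s ∈ S \ {x}, Joined G ((S ∪ S') \ {x}) y s :=
        fun s hs hs' hsx => ⟨s, ⟨hs, hsx⟩, (hS'.2.2 x y ⟨hy, hyx⟩ s ⟨hs', hsx⟩).mono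
          (Set.sdiff_subset_sdiff_left Set.subset_union_right)⟩
      by_cases hax : a = x
      · exact key b hb hb' fun h => hab (hax.trans h.symm)
      · exact key a ha ha' hax

/-- Adding an ear to a nonseparable set keeps it nonseparable. -/
theorem IsNonseparable.union_ear (hS : IsNonseparable G S) {p : G.Walk a b} (hp : p.IsPath)
    (ha : a ∈ S) (hb : b ∈ S) : IsNonseparable G (S ∪ {z | z ∈ p.support}) := by
  refine ⟨hS.1.inl, hS.2.1.extend Set.subset_union_left ?_, fun x =>
    (hS.2.2 x).extend (Set.sdiff_subset_sdiff_left Set.subset_union_left) ?_⟩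
  · rintro y (hy | hy)
    · exact ⟨y, hy, Joined.refl (.inl hy)⟩
    · classical
      refine ⟨b, hb, p.dropUntil y hy, fun z hz => .inr ?_⟩
      exact p.support_dropUntil_subset_support hy hz
  · rintro y ⟨hy | hy, hyx⟩
    · exact ⟨y, ⟨hy, hyx⟩, Joined.refl ⟨.inl hy, hyx⟩⟩
    · have hsub : {z | z ∈ p.support} \ {x} ⊆ (S ∪ {z | z ∈ p.support}) \ {x} :=
        Set.sdiff_subset_sdiff_left Set.subset_union_right
      rcases joined_end_of_isPath hp hy hyx with h | h
      · exact ⟨a, ⟨ha, h.right_mem.2⟩, h.mono hsub⟩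
      · exact ⟨b, ⟨hb, h.right_mem.2⟩, h.mono hsub⟩

theorem IsBlock.eq_of_mem_of_mem (hB : IsBlock G B) (hB' : IsBlock G B') (hab : a ≠ b)
    (ha : a ∈ B) (ha' : a ∈ B') (hb : b ∈ B) (hb' : b ∈ B') : B = B' := by
  have h := hB.isNonseparable.union hB'.isNonseparable hab ha ha' hb hb'
  exact (hB.eq_of_subset h Set.subset_union_left).trans
    (hB'.eq_of_subset h Set.subset_union_right).symm

/-- Distinct blocks that share `v` are separated by `v`. -/
theorem IsBlock.eq_of_joined (hB : IsBlock G B) (hB' : IsBlock G B') (hv : v ∈ B) (hv' : v ∈ B')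
    (ha : a ∈ B) (hb : b ∈ B') (h : Joined G {v}ᶜ a b) : B = B' := by
  classical
  -- With `c` a neighbour of `v` in `B'`, a path from `a` to `c` avoiding `v`, closed by the edge
  -- `cv`, is an ear on `B`. Maximality puts `c` in `B`, so the two blocks share both `v` and `c`.
  obtain ⟨c, hc, hvc⟩ := (hB'.isNonseparable.2.1 v hv' b hb).exists_adj (Ne.symm h.right_mem)
  have hac : Joined G {v}ᶜ a c := h.trans
    ((hB'.isNonseparable.2.2 v b ⟨hb, h.right_mem⟩ c ⟨hc, hvc.ne'⟩).mono fun _ h => h.2)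
  obtain ⟨p, hp⟩ := hac
  have hv_notMem : v ∉ p.bypass.support := fun h => hp v (p.support_bypass_subset_support h) rfl
  have hpath : (p.bypass.concat hvc.symm).IsPath := p.bypass_isPath.concat hv_notMem hvc.symm
  have hear := hB.isNonseparable.union_ear hpath ha hv
  have hcB : c ∈ B := by
    rw [hB.eq_of_subset hear Set.subset_union_left]
    exact .inr (by simp [SimpleGraph.Walk.support_concat])
  exact hB.eq_of_mem_of_mem hB' hvc.ne hv hv' hcB hc

theorem IsNonseparable.exists_isBlock [Finite V] (hS : IsNonseparable G S) :
    ∃ B, IsBlock G B ∧ S ⊆ B := by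
  obtain ⟨B, hSB, hB⟩ := Finite.exists_le_maximal hS
  exact ⟨B, isBlock_iff.2 hB, hSB⟩

theorem exists_isBlock_mem [Finite V] (v : V) : ∃ B, IsBlock G B ∧ v ∈ B := by
  have hv : IsNonseparable G {v} := ⟨⟨v, rfl⟩, isJoinedSet_of_subsingleton (by simp),
    fun x => isJoinedSet_of_subsingleton (Set.subsingleton_singleton.anti Set.sdiff_subset)⟩
  obtain ⟨B, hB, h⟩ := hv.exists_isBlock
  exact ⟨B, hB, h rfl⟩

theorem IsBlock.exists_ne_mem (hG : G.Connected) (hB : IsBlock G B)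
    (hcut : IsCutVertex G v) : ∃ b ∈ B, b ≠ v := by
  by_contra! h
  obtain ⟨a, -⟩ := hcut
  obtain ⟨c, -, hvc⟩ := (joined_univ_iff.2 (hG.preconnected v a.1)).exists_adj (Ne.symm a.2)
  have hc : c ∈ B := by
    rw [hB.eq_of_subset (isNonseparable_pair hvc) fun b hb => .inl (h b hb)]
    simp
  exact hvc.ne' (h c hc)

theorem IsBlock.eq_of_not_isCutVertex (hG : G.Connected) (hv : ¬ IsCutVertex G v)
    (hB : IsBlock G B) (hB' : IsBlock G B') (h : v ∈ B) (h' : v ∈ B') : B = B' := by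
  by_cases hs : B ⊆ {v}
  · exact hB.eq_of_subset hB'.isNonseparable fun b hb => hs hb ▸ h'
  by_cases hs' : B' ⊆ {v}
  · exact (hB'.eq_of_subset hB.isNonseparable fun b hb => hs' hb ▸ h).symm
  obtain ⟨a, ha, hav⟩ := Set.not_subset.1 hs
  obtain ⟨b, hb, hbv⟩ := Set.not_subset.1 hs'
  exact hB.eq_of_joined hB' h h' ha hb ((not_isCutVertex_iff hG).1 hv a b hav hbv)

/-! ### The block graph is a tree of total weight `n` -/

theorem not_reachable_deleteEdges_blockTree (hG : G.Connected) {v : {v : V // IsCutVertex G v}}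
    {B : {B : Set V // IsBlock G B}} (hvB : v.1 ∈ B.1) :
    ¬ ((blockTree G).deleteEdges {s(.inl v, .inr B)}).Reachable (.inr B) (.inl v) := by
  obtain ⟨b, hb, hbv⟩ := B.2.exists_ne_mem hG v.2
  -- the nodes on the side of `B` meet `G - v` only in the component of `b`
  let Q : Node G → Prop := fun x => match x with
    | .inl u => Joined G {v.1}ᶜ b u.1
    | .inr B' => ∀ u ∈ B'.1, u ≠ v.1 → Joined G {v.1}ᶜ b u
  have hstep : ∀ x y, ((blockTree G).deleteEdges {s(.inl v, .inr B)}).Adj x y → Q x → Q y := by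
    rintro (u | B₁) (u' | B₂) hxy hQ
    · exact hxy.1.elim
    · intro u' hu' hne
      have hu : u.1 ∈ B₂.1 := (SimpleGraph.deleteEdges_adj.1 hxy).1
      exact Joined.trans hQ ((B₂.2.isNonseparable.2.2 v.1 _ ⟨hu, Joined.right_mem hQ⟩ _
        ⟨hu', hne⟩).mono fun _ h => h.2)
    · have hu : u'.1 ∈ B₁.1 := (SimpleGraph.deleteEdges_adj.1 hxy).1
      -- Reaching `v` from a block `B₁` would put `B₁` and `B` on the same side of `v`, which forces
      -- `B₁ = B`; the step would then use the deleted edge.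
      have hne : u' ≠ v := by
        rintro rfl
        obtain ⟨d, hd, hdv⟩ := B₁.2.exists_ne_mem hG u'.2
        have : B = B₁ := Subtype.ext (B.2.eq_of_joined B₁.2 hvB hu hb hd (hQ d hd hdv))
        subst this
        exact (SimpleGraph.deleteEdges_adj.1 hxy).2 (Sym2.eq_swap)
      exact hQ u'.1 hu fun h => hne (Subtype.ext h)
    · exact hxy.1.elim
  have hwalk : ∀ x y, ((blockTree G).deleteEdges {s(.inl v, .inr B)}).Walk x y → Q x → Q y := by
    intro x y p
    induction p with
    | nil => exact id
    | cons h _ ih => exact fun hx => ih (hstep _ _ h hx)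
  rintro ⟨p⟩
  refine (hwalk _ _ p ?_ : Joined G {v.1}ᶜ b v.1).right_mem rfl
  exact fun u hu huv => (B.2.isNonseparable.2.2 v.1 b ⟨hb, hbv⟩ u ⟨hu, huv⟩).mono fun _ h => h.2

/-- Each edge of the walk lies in a block. Consecutive blocks share a vertex, which either is a cut
vertex adjacent to both or forces them to be equal. -/
theorem reachable_blockTree [Finite V] (hG : G.Connected) {B B' : {B : Set V // IsBlock G B}}
    (p : G.Walk a b) (ha : a ∈ B.1) (hb : b ∈ B'.1) :
    (blockTree G).Reachable (.inr B) (.inr B') := by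
  have same : ∀ (B B' : {B : Set V // IsBlock G B}) (c : V), c ∈ B.1 → c ∈ B'.1 →
      (blockTree G).Reachable (.inr B) (.inr B') := fun B B' c hc hc' => by
    by_cases hcut : IsCutVertex G c
    · have h₁ : (blockTree G).Adj (.inl ⟨c, hcut⟩) (.inr B) := hc
      have h₂ : (blockTree G).Adj (.inl ⟨c, hcut⟩) (.inr B') := hc'
      exact h₁.symm.reachable.trans h₂.reachable
    · rw [Subtype.ext (B.2.eq_of_not_isCutVertex hG hcut B'.2 hc hc')]
  induction p generalizing B with
  | nil => exact same B B' _ ha hb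
  | cons h _ ih =>
    obtain ⟨D, hD, hsub⟩ := (isNonseparable_pair h).exists_isBlock
    exact (same B ⟨D, hD⟩ _ ha (hsub (by simp))).trans (ih (B := ⟨D, hD⟩) (hsub (by simp)) hb)

theorem blockTree_isTree [Finite V] (hG : G.Connected) : (blockTree G).IsTree := by
  have hblock : ∀ x : Node G, ∃ B, (blockTree G).Reachable x (.inr B) := by
    rintro (v | B)
    · obtain ⟨B, hB, hv⟩ := exists_isBlock_mem (G := G) v.1
      exact ⟨⟨B, hB⟩, SimpleGraph.Adj.reachable (G := blockTree G) hv⟩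
    · exact ⟨B, .refl _⟩
  refine ⟨(SimpleGraph.connected_iff _).2 ⟨fun x y => ?_, ?_⟩,
    SimpleGraph.isAcyclic_iff_forall_adj_isBridge.2 ?_⟩
  · obtain ⟨B, hB⟩ := hblock x
    obtain ⟨B', hB'⟩ := hblock y
    obtain ⟨a, ha⟩ := B.2.isNonseparable.1
    obtain ⟨b, hb⟩ := B'.2.isNonseparable.1
    obtain ⟨p⟩ := hG.preconnected a b
    exact (hB.trans (reachable_blockTree hG p ha hb)).trans hB'.symm
  · obtain ⟨v⟩ := hG.nonempty
    obtain ⟨B, hB, -⟩ := exists_isBlock_mem (G := G) v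
    exact ⟨.inr ⟨B, hB⟩⟩
  · rintro (v | B) (v' | B') h
    · exact h.elim
    · exact fun hr => not_reachable_deleteEdges_blockTree hG h hr.symm
    · rw [Sym2.eq_swap]
      exact fun hr => not_reachable_deleteEdges_blockTree hG h hr.symm
    · exact h.elim

/-- Send a cut vertex to its own node and any other vertex to its unique block: the weights are the
sizes of the fibres of this map. -/
theorem setWeight_univ_weight [Finite V] (hG : G.Connected) :
    setWeight (weight G) Set.univ = Nat.card V := by
  classical
  have := Fintype.ofFinite V
  have := Fintype.ofFinite (Node G)
  choose blk hblk hmem using exists_isBlock_mem (G := G)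
  let f : V → Node G := fun v =>
    if h : IsCutVertex G v then .inl ⟨v, h⟩ else .inr ⟨blk v, hblk v⟩
  have hfib : ∀ x : Node G, weight G x = (Finset.univ.filter fun v => f v = x).card := by
    rintro (u | B)
    · have : (Finset.univ.filter fun v => f v = .inl u) = {u.1} := by
        ext v
        simp only [Finset.mem_filter, Finset.mem_univ, true_and, Finset.mem_singleton, f]
        split_ifs with h
        · simp [Subtype.ext_iff]
        · simp only [false_iff]
          rintro rfl
          exact h u.2
      rw [this, Finset.card_singleton]
      rfl
    · rw [← Set.ncard_coe_finset]
      refine congrArg Set.ncard (Set.ext fun v => ?_)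
      simp only [Set.mem_ofPred_eq, Finset.coe_filter, Finset.mem_univ, true_and, f]
      split_ifs with h
      · simp [h]
      · simp only [h, not_false_eq_true, and_true, Sum.inr.injEq, Subtype.ext_iff]
        exact ⟨fun hv => (hblk v).eq_of_not_isCutVertex hG h B.2 (hmem v) hv, fun e => e ▸ hmem v⟩
  rw [setWeight, finsum_mem_univ, finsum_eq_sum_of_fintype, Finset.sum_congr rfl fun x _ => hfib x,
    ← Finset.card_eq_sum_card_fiberwise fun _ _ => Finset.mem_coe.2 (Finset.mem_univ _),
    Finset.card_univ, Nat.card_eq_fintype_card]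

theorem isCutVertex_of_weight_eq_zero [Finite V] {B : {B : Set V // IsBlock G B}}
    (h : weight G (.inr B) = 0) (hv : v ∈ B.1) : IsCutVertex G v := by
  by_contra hcut
  have h' : {x : V | x ∈ B.1 ∧ ¬ IsCutVertex G x} = ∅ := (Set.ncard_eq_zero).1 h
  exact h'.le ⟨hv, hcut⟩

end Blocks

/-! ### Central centroids, subtrees of a half, and halving vertices -/

section WeightedTree

variable {W : Type*} {T : SimpleGraph W} {w : W → ℕ} {x y z u v c : W} {n : ℕ}

/-- Connectedness and the nonadjacency of `v` and `u` make `c` adjacent to both, so only `c` has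
eccentricity at most one. The walk is arbitrary because `IsCentralCentroid` does not fix the path
carrying the centroids. -/
theorem mem_center_iff_eq {a b : W} {P : T.Walk a b}
    (hP : P.toSubgraph.verts = {v, c, u}) (hvu : v ≠ u)
    (hadj : ¬ T.Adj v u) (s : P.toSubgraph.verts) :
    s ∈ P.toSubgraph.coe.center ↔ s.1 = c := by
  have hv : v ∈ P.toSubgraph.verts := hP ▸ by simp
  have hc : c ∈ P.toSubgraph.verts := hP ▸ by simp
  have hu : u ∈ P.toSubgraph.verts := hP ▸ by simp
  have hmem : ∀ t : P.toSubgraph.verts, t = ⟨v, hv⟩ ∨ t = ⟨c, hc⟩ ∨ t = ⟨u, hu⟩ := fun t => by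
    have ht : t.1 ∈ ({v, c, u} : Set W) := hP ▸ t.2
    simpa [Subtype.ext_iff] using ht
  have hconn : P.toSubgraph.coe.Connected := P.toSubgraph_connected.coe
  have hno : ¬ P.toSubgraph.coe.Adj ⟨v, hv⟩ ⟨u, hu⟩ := fun h => hadj h.adj_sub
  have hne : (⟨v, hv⟩ : P.toSubgraph.verts) ≠ ⟨u, hu⟩ := fun h => hvu (congrArg Subtype.val h)
  have hcv' : P.toSubgraph.coe.Adj ⟨c, hc⟩ ⟨v, hv⟩ := by
    obtain ⟨t, -, ht⟩ := (joined_univ_iff.2 (hconn.preconnected ⟨v, hv⟩ ⟨u, hu⟩)).exists_adj hne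
    rcases hmem t with rfl | rfl | rfl
    exacts [absurd rfl ht.ne, ht.symm, absurd ht hno]
  have hcu' : P.toSubgraph.coe.Adj ⟨c, hc⟩ ⟨u, hu⟩ := by
    obtain ⟨t, -, ht⟩ :=
      (joined_univ_iff.2 (hconn.preconnected ⟨u, hu⟩ ⟨v, hv⟩)).exists_adj hne.symm
    rcases hmem t with rfl | rfl | rfl
    exacts [absurd ht.symm hno, ht.symm, absurd rfl ht.ne]
  have hecc : P.toSubgraph.coe.eccent ⟨c, hc⟩ ≤ 1 := by
    rw [SimpleGraph.eccent_le_one_iff]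
    intro t ht
    rcases hmem t with rfl | rfl | rfl
    exacts [hcv', absurd rfl ht, hcu']
  have himp : ∀ t ∈ P.toSubgraph.coe.center, t = ⟨c, hc⟩ := fun t ht => by
    have h₁ : P.toSubgraph.coe.eccent t ≤ 1 := by
      rw [(SimpleGraph.mem_center_iff t).1 ht]
      exact SimpleGraph.radius_le_eccent.trans hecc
    rw [SimpleGraph.eccent_le_one_iff] at h₁
    rcases hmem t with rfl | rfl | rfl
    · exact absurd (h₁ _ hne) hno
    · rfl
    · exact absurd (h₁ _ hne.symm).symm hno
  constructor
  · exact fun hs => congrArg Subtype.val (himp s hs)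
  · intro hs
    have : Nonempty P.toSubgraph.verts := ⟨s⟩
    obtain ⟨t, ht⟩ := SimpleGraph.center_nonempty (G := P.toSubgraph.coe)
    rwa [Subtype.ext (hs.trans (congrArg Subtype.val (himp t ht)).symm)]

theorem isCentralCentroid_iff_eq (hcent : centroids T w = {v, c, u}) (hvc : T.Adj v c)
    (hcu : T.Adj c u) (hvu : v ≠ u) (hadj : ¬ T.Adj v u) (x : W) :
    IsCentralCentroid T w x ↔ x = c := by
  constructor
  · rintro ⟨a, b, P, -, hP, hx, hxc⟩
    exact (mem_center_iff_eq (hP.trans hcent) hvu hadj _).1 hxc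
  · rintro rfl
    let P : T.Walk v u := .cons hvc (.cons hcu .nil)
    have hP : P.toSubgraph.verts = {v, x, u} := by
      ext t
      simp only [SimpleGraph.Walk.mem_verts_toSubgraph, P, SimpleGraph.Walk.support_cons,
        SimpleGraph.Walk.support_nil, List.mem_cons, List.not_mem_nil, or_false,
        Set.mem_insert_iff, Set.mem_singleton_iff]
    refine ⟨v, u, P, ?_, hP.trans hcent.symm, hP ▸ by simp, ?_⟩
    · simp [P, hvc.ne, hcu.ne, hvu]
    · exact (mem_center_iff_eq hP hvu hadj _).2 rfl

section Halves

variable [Finite W]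

theorem properSubtreesWeighAtMost_branch (hT : T.IsTree) (hw : setWeight w Set.univ = n)
    (hzero : ∀ x, w x = 0 → ∃ y z, y ≠ z ∧ T.Adj x y ∧ T.Adj x z ∧ w y ≠ 0 ∧ w z ≠ 0)
    (hyc : T.Adj y c) (hh : 2 * setWeight w (branch T y c) = n)
    (hcent : centroids T w ⊆ {y, c}) :
    ProperSubtreesWeighAtMost T w (branch T y c) ((n : ℚ) / 2 - 1) := by
  intro S hSU hS
  by_contra hlt
  have hle : n ≤ 2 * setWeight w S := by
    have h₁ : (n : ℚ) < 2 * setWeight w S + 2 := by linarith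
    have h₂ : n < 2 * setWeight w S + 2 := by exact_mod_cast h₁
    -- `n` is even by `hh`, so weight above `n/2 - 1` means weight at least `n/2`.
    omega
  have hrest : setWeight w (branch T y c \ S) = 0 := by
    have := setWeight_union (w := w) (Set.disjoint_sdiff_right (s := S) (t := branch T y c))
    rw [Set.union_sdiff_cancel hSU.1] at this
    omega
  have hout : ∀ x ∈ branch T y c, x ∉ S → w x = 0 := fun x hx hxS => by
    have hmem : x ∈ branch T y c \ S := ⟨hx, hxS⟩
    have := setWeight_mono (w := w) (Set.singleton_subset_iff.2 hmem)
    rw [setWeight_singleton] at this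
    omega
  have hjoin : IsJoinedSet T S := preconnected_induce_iff.1 hS.preconnected
  obtain ⟨x, hx, hxS⟩ := Set.exists_of_ssubset hSU
  have hSx : S ⊆ {x}ᶜ := fun s hs hsx => hxS (hsx ▸ hs)
  -- If `S` misses `c`, it fills the weight of a branch at `c` away from `y`, whose neighbour of `c`
  -- would be a third centroid. If it misses another `x`, then `x` has weight zero and two
  -- neighbours of positive weight; these belong to `S`, which joins them avoiding `x`, impossible
  -- in a tree.
  by_cases hxc : x = c
  · subst hxc
    obtain ⟨s, hs⟩ := hS.nonempty
    have h₁ := setWeight_mono (w := w) fun t ht => (hjoin s hs t ht).mono hSx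
    have hsy : s ∉ branch T x y :=
      Set.disjoint_left.1 (disjoint_branch_branch hT.isAcyclic hyc) (hSU.1 hs)
    have h₂ := setWeight_mono (w := w) (branch_subset_branch hT.connected hyc.ne hsy)
    obtain ⟨u, hu, hus⟩ := exists_adj_mem_branch hT.connected (hSx hs)
    have h₃ : 2 * setWeight w (branch T x u) = n := by
      rw [branch_eq_of_mem hus]
      exact le_antisymm (by omega) (hle.trans (Nat.mul_le_mul_left 2 h₁))
    rcases hcent (mem_centroids_of_half hT hw hu.symm (half_comm hT hw hu h₃)) with rfl | rfl
    · exact hsy (mem_branch_comm hus)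
    · exact hu.ne rfl
  · obtain ⟨z₁, z₂, hne, hz₁, hz₂, hw₁, hw₂⟩ := hzero x (hout x hx hxS)
    have hin : ∀ z, T.Adj x z → w z ≠ 0 → z ∈ S := fun z hz hwz => by
      by_contra hzS
      refine hwz (hout z (Joined.trans hx (Joined.of_adj hz hx.right_mem ?_)) hzS)
      rintro rfl
      exact hxc (eq_of_adj_of_mem_branch hT.isAcyclic hyc hz.symm hx)
    exact hne (eq_of_adj_of_mem_branch hT.isAcyclic hz₂ hz₁
      ((hjoin _ (hin _ hz₂ hw₂) _ (hin _ hz₁ hw₁)).mono hSx))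

theorem edgeHalves_of_half (hT : T.IsTree) (hw : setWeight w Set.univ = n)
    (hzero : ∀ x, w x = 0 → ∃ y z, y ≠ z ∧ T.Adj x y ∧ T.Adj x z ∧ w y ≠ 0 ∧ w z ≠ 0)
    (hxy : T.Adj x y) (hh : 2 * setWeight w (branch T x y) = n)
    (hcent : centroids T w ⊆ {x, y}) : EdgeHalves T w n x y := by
  have hh' := half_comm hT hw hxy hh
  have hx : ((T.deleteEdges {s(x, y)}).connectedComponentMk x).supp = branch T y x := by
    rw [Sym2.eq_swap, supp_deleteEdges_eq_branch hT hxy.symm]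
  have hy := supp_deleteEdges_eq_branch hT hxy
  have hq : (2 * setWeight w (branch T x y) : ℚ) = n := by exact_mod_cast hh
  have hq' : (2 * setWeight w (branch T y x) : ℚ) = n := by exact_mod_cast hh'
  refine ⟨_, _, rfl, rfl, fun h => not_reachable_deleteEdges hT.isAcyclic hxy
    (SimpleGraph.ConnectedComponent.eq.1 h), fun C => ?_, ?_, ?_, ?_, ?_⟩
  · induction C using SimpleGraph.ConnectedComponent.ind with
    | _ z =>
      rcases (branch_union_branch hT.connected hxy.ne).ge (Set.mem_univ z) with h | h
      · exact .inr (hy.ge h)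
      · exact .inl (hx.ge h)
  · rw [hx]
    linarith
  · rw [hy]
    linarith
  · rw [hx]
    exact properSubtreesWeighAtMost_branch hT hw hzero hxy.symm hh' (Set.pair_comm x y ▸ hcent)
  · rw [hy]
    exact properSubtreesWeighAtMost_branch hT hw hzero hxy hh hcent

/-- A vertex with two branches of half the total weight has no further neighbour of positive
weight. -/
theorem eq_or_eq_of_two_halves (hT : T.IsTree) (hw : setWeight w Set.univ = n)
    (hx : T.Adj c x) (hy : T.Adj c y) (hz : T.Adj c z) (hxy : x ≠ y)
    (hcx : 2 * setWeight w (branch T c x) = n) (hcy : 2 * setWeight w (branch T c y) = n)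
    (hwz : w z ≠ 0) : z = x ∨ z = y := by
  by_contra! hne
  have hdisj : Disjoint (branch T c x) (branch T c y) :=
    disjoint_branch fun h => hxy (eq_of_adj_of_mem_branch hT.isAcyclic hy hx h)
  have hzout : Disjoint (branch T c x ∪ branch T c y) {z} := by
    rw [Set.disjoint_singleton_right]
    rintro (h | h)
    · exact hne.1 (eq_of_adj_of_mem_branch hT.isAcyclic hx hz h)
    · exact hne.2 (eq_of_adj_of_mem_branch hT.isAcyclic hy hz h)
  have h := setWeight_mono (w := w) (Set.subset_univ (branch T c x ∪ branch T c y ∪ {z}))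
  rw [setWeight_union hzout, setWeight_union hdisj, setWeight_singleton, hw] at h
  omega

end Halves

theorem connectedComponentMk_eq_iff (hx : x ≠ c) (hy : y ≠ c) :
    (T.induce ({c}ᶜ : Set W)).connectedComponentMk ⟨x, hx⟩ =
      (T.induce ({c}ᶜ : Set W)).connectedComponentMk ⟨y, hy⟩ ↔ y ∈ branch T c x := by
  rw [SimpleGraph.ConnectedComponent.eq]
  exact (joined_iff_reachable_induce (S := ({c}ᶜ : Set W)) hx hy).symm

theorem vertexHalves_of_two_halves (hT : T.IsAcyclic) (hx : T.Adj c x) (hy : T.Adj c y)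
    (hxy : x ≠ y) (hcx : 2 * setWeight w (branch T c x) = n)
    (hcy : 2 * setWeight w (branch T c y) = n)
    (hcover : ∀ t, t ≠ c → t ∈ branch T c x ∨ t ∈ branch T c y) : VertexHalves T w n c := by
  refine ⟨(T.induce ({c}ᶜ : Set W)).connectedComponentMk ⟨x, hx.ne'⟩,
    (T.induce ({c}ᶜ : Set W)).connectedComponentMk ⟨y, hy.ne'⟩, fun h => ?_, fun C => ?_, ?_, ?_⟩
  · exact hxy (eq_of_adj_of_mem_branch hT hx hy
      ((connectedComponentMk_eq_iff hx.ne' hy.ne').1 h)).symm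
  · obtain ⟨t, ht, rfl⟩ := exists_subtreeVerts_eq C
    exact (hcover t ht).imp (fun h => ((connectedComponentMk_eq_iff hx.ne' ht).2 h).symm)
      fun h => ((connectedComponentMk_eq_iff hy.ne' ht).2 h).symm
  · rw [subtreeVerts_mk, eq_div_iff two_ne_zero, mul_comm]
    exact_mod_cast hcx
  · rw [subtreeVerts_mk, eq_div_iff two_ne_zero, mul_comm]
    exact_mod_cast hcy

/-- A component of `T - x` of half the total weight is the branch of a neighbour of `x`. -/
theorem exists_adj_half (hT : T.Connected) (C : (T.induce ({x}ᶜ : Set W)).ConnectedComponent)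
    (hC : (setWeight w (subtreeVerts T x C) : ℚ) = n / 2) :
    ∃ (u : W) (hu : T.Adj x u), C = (T.induce ({x}ᶜ : Set W)).connectedComponentMk ⟨u, hu.ne'⟩ ∧
      2 * setWeight w (branch T x u) = n := by
  obtain ⟨y, hy, rfl⟩ := exists_subtreeVerts_eq C
  obtain ⟨u, hu, huy⟩ := exists_adj_mem_branch hT hy
  rw [subtreeVerts_mk] at hC
  refine ⟨u, hu, ?_, ?_⟩
  · exact (connectedComponentMk_eq_iff hy hu.ne').2 huy
  · rw [branch_eq_of_mem huy]
    have : (2 * setWeight w (branch T x y) : ℚ) = n := by linarith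
    exact_mod_cast this

end WeightedTree

/-! ### The three alternatives and their exclusivity -/

section Blocks

variable {V : Type*} {G : SimpleGraph V} {n : ℕ}

theorem weight_inl_ne_zero (v : {v : V // IsCutVertex G v}) : weight G (.inl v) ≠ 0 := one_ne_zero

theorem exists_adj_of_weight_eq_zero [Finite V] (hG : G.Connected) (x : Node G)
    (hx : weight G x = 0) :
    ∃ y z, y ≠ z ∧ (blockTree G).Adj x y ∧ (blockTree G).Adj x z ∧
      weight G y ≠ 0 ∧ weight G z ≠ 0 := by
  rcases x with v | B
  · exact absurd hx one_ne_zero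
  · obtain ⟨a, ha⟩ := B.2.isNonseparable.1
    have hcut := isCutVertex_of_weight_eq_zero hx ha
    obtain ⟨b, hb, hba⟩ := B.2.exists_ne_mem hG hcut
    refine ⟨.inl ⟨a, hcut⟩, .inl ⟨b, isCutVertex_of_weight_eq_zero hx hb⟩, ?_, ha, hb,
      one_ne_zero, one_ne_zero⟩
    simpa using hba.symm

theorem nonempty_iso_of_isBlock_pair {a b : V} (hab : a ≠ b) (hB : IsBlock G {a, b}) :
    Nonempty (G.induce ({a, b} : Set V) ≃g (⊤ : SimpleGraph (Fin 2))) := by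
  have hadj : G.Adj a b := by
    obtain ⟨c, rfl | rfl, hc⟩ :=
      (hB.isNonseparable.2.1 a (by simp) b (by simp)).exists_adj hab
    exacts [absurd rfl hc.ne, hc]
  have htop : G.induce ({a, b} : Set V) = ⊤ := by
    ext ⟨s, hs⟩ ⟨t, ht⟩
    simp only [SimpleGraph.induce_adj, SimpleGraph.top_adj, ne_eq, Subtype.mk.injEq]
    refine ⟨fun h => h.ne, fun h => ?_⟩
    rcases hs with rfl | rfl <;> rcases ht with rfl | rfl
    exacts [absurd rfl h, hadj, hadj.symm, absurd rfl h]
  rw [htop]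
  exact ⟨.completeGraph (Finite.equivFinOfCardEq (Set.ncard_pair hab))⟩

theorem twoCentroids_or_zeroWeightCentralBlock [Finite V] (hG : G.Connected) (hn : Nat.card V = n)
    {v : {v : V // IsCutVertex G v}} {B : {B : Set V // IsBlock G B}} (hvB : v.1 ∈ B.1)
    (hh : 2 * setWeight (weight G) (branch (blockTree G) (.inl v) (.inr B)) = n) :
    TwoCentroids G n ∨ ZeroWeightCentralBlock G n := by
  have hT := blockTree_isTree hG
  have hw : setWeight (weight G) Set.univ = n := (setWeight_univ_weight hG).trans hn
  have hadj : (blockTree G).Adj (.inl v) (.inr B) := hvB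
  have hh' := half_comm hT hw hadj hh
  have hv := mem_centroids_of_half hT hw hadj hh
  have hB := mem_centroids_of_half hT hw hadj.symm hh'
  by_cases hx : centroids (blockTree G) (weight G) ⊆ {.inl v, .inr B}
  · refine .inl ⟨v, B, hvB, hx.antisymm ?_,
      edgeHalves_of_half hT hw (exists_adj_of_weight_eq_zero hG) hadj hh hx⟩
    exact Set.insert_subset hv (Set.singleton_subset_iff.2 hB)
  right
  -- A third centroid `x` lies beyond `B`, which forces `B` to weigh zero and to have a second half
  -- branch, that of a cut vertex `u`.
  obtain ⟨x, hxc, hx⟩ := Set.not_subset.1 hx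
  have hxv : x ≠ .inl v := fun h => hx (.inl h)
  have hxB : x ≠ .inr B := fun h => hx (.inr h)
  have hbeyond : ∀ t ∈ centroids (blockTree G) (weight G), t ≠ .inl v →
      t ∈ branch (blockTree G) (.inl v) (.inr B) := fun t ht htv =>
    ((branch_union_branch hT.connected hadj.ne).ge (Set.mem_univ t)).resolve_right fun h =>
      weight_inl_ne_zero v (weight_eq_zero_of_centroid hT hw hadj.symm hh' ht h htv)
  have hxb := hbeyond x hxc hxv
  have hB0 := weight_eq_zero_of_centroid hT hw hadj hh hxc hxb hxB
  have hxh := half_of_centroid hT hw hadj hh hxc hxb hxB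
  have hout := Set.disjoint_left.1 (disjoint_branch_branch hT.isAcyclic hadj)
  obtain ⟨u | D, hu, hux⟩ := exists_adj_mem_branch hT.connected hxB
  swap
  · exact hu.elim
  have huh : 2 * setWeight (weight G) (branch (blockTree G) (.inr B) (.inl u)) = n := by
    rwa [branch_eq_of_mem hux]
  have huv : (.inl v : Node G) ≠ .inl u := by
    intro h
    rw [← h] at hux
    exact hout hxb (mem_branch_comm hux)
  have huB : u.1 ∈ B.1 := hu
  have hnbr : ∀ z : {v : V // IsCutVertex G v}, z.1 ∈ B.1 →
      (.inl z : Node G) = .inl v ∨ (.inl z : Node G) = .inl u := fun z hz => by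
    have hzB : (blockTree G).Adj (.inr B) (.inl z) := hz
    exact eq_or_eq_of_two_halves hT hw hadj.symm hu hzB huv hh' huh (weight_inl_ne_zero z)
  have hpair : B.1 = {v.1, u.1} := by
    ext b
    refine ⟨fun hb => ?_, ?_⟩
    · rcases hnbr ⟨b, isCutVertex_of_weight_eq_zero hB0 hb⟩ hb with h | h
      · exact .inl (congrArg Subtype.val (Sum.inl.inj h))
      · exact .inr (congrArg Subtype.val (Sum.inl.inj h))
    · rintro (rfl | rfl)
      exacts [hvB, huB]
  have hbr : ∀ t, t ≠ .inr B → t ∈ branch (blockTree G) (.inr B) (.inl v) ∨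
      t ∈ branch (blockTree G) (.inr B) (.inl u) := fun t ht => by
    obtain ⟨z | D, hz, hzt⟩ := exists_adj_mem_branch hT.connected ht
    · rcases hnbr z hz with h | h
      · exact .inl (h ▸ mem_branch_comm hzt)
      · exact .inr (h ▸ mem_branch_comm hzt)
    · exact hz.elim
  have hcent : centroids (blockTree G) (weight G) = {.inl v, .inr B, .inl u} := by
    refine Set.Subset.antisymm (fun t ht => ?_) ?_
    · by_contra hne
      simp only [Set.mem_insert_iff, Set.mem_singleton_iff, not_or] at hne
      rcases hbr t hne.2.1 with h | h
      · exact hout (hbeyond t ht hne.1) h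
      · exact weight_inl_ne_zero u (weight_eq_zero_of_centroid hT hw hu huh ht h hne.2.2)
    · rintro t (rfl | rfl | rfl)
      exacts [hv, hB, mem_centroids_of_half hT hw hu.symm (half_comm hT hw hu huh)]
  -- `id` shows that two cut vertices are not adjacent, as their adjacency unfolds to `False`.
  refine ⟨B, hB0, isCentralCentroid_iff_eq hcent hadj hu huv id, ?_, ?_⟩
  · exact vertexHalves_of_two_halves hT.isAcyclic hadj.symm hu huv hh' huh hbr
  · rw [hpair]
    exact nonempty_iso_of_isBlock_pair (fun h => huv (congrArg Sum.inl (Subtype.ext h)))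
      (hpair ▸ B.2)

theorem oneCentroid_or_twoCentroids_or_zeroWeightCentralBlock [Finite V] (hG : G.Connected)
    (hn : Nat.card V = n) : OneCentroid G n ∨ TwoCentroids G n ∨ ZeroWeightCentralBlock G n := by
  have hT := blockTree_isTree hG
  have hw : setWeight (weight G) Set.univ = n := (setWeight_univ_weight hG).trans hn
  have := hG.nonempty
  -- Positivity of `n` makes `hs c` positive in the case of equality, so that a heaviest branch
  -- exists.
  have hpos : 0 < n := hn ▸ Nat.card_pos
  obtain ⟨c, hc⟩ := exists_two_mul_hs_le hT hw
  rcases hc.lt_or_eq with hlt | heq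
  · refine .inl ⟨c, centroids_eq_singleton hT hw hlt, ?_⟩
    rw [lt_div_iff₀ two_pos, mul_comm]
    exact_mod_cast hlt
  · right
    obtain ⟨y, hy, hcy⟩ := exists_branch_eq_hs (w := weight G) hT.connected (x := c) (by omega)
    rw [← hcy] at heq
    rcases c with v | B <;> rcases y with v' | B'
    · exact hy.elim
    · exact twoCentroids_or_zeroWeightCentralBlock hG hn hy heq
    · exact twoCentroids_or_zeroWeightCentralBlock hG hn hy (half_comm hT hw hy heq)
    · exact hy.elim

theorem mem_centroids_of_isCentralCentroid {W : Type*} {T : SimpleGraph W} {w : W → ℕ} {c : W}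
    (h : IsCentralCentroid T w c) : c ∈ centroids T w := by
  obtain ⟨_, _, _, -, hP, hc, -⟩ := h
  exact hP ▸ hc

theorem not_oneCentroid_and_twoCentroids : ¬ (OneCentroid G n ∧ TwoCentroids G n) := by
  rintro ⟨⟨c, hc, -⟩, v, B, -, hvB, -⟩
  have h₁ : (.inl v : Node G) = c := by
    simpa [hc] using hvB.ge (.inl rfl)
  have h₂ : (.inr B : Node G) = c := by
    simpa [hc] using hvB.ge (.inr rfl)
  exact Sum.inl_ne_inr (h₁.trans h₂.symm)

theorem not_oneCentroid_and_zeroWeightCentralBlock [Finite V] :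
    ¬ (OneCentroid G n ∧ ZeroWeightCentralBlock G n) := by
  rintro ⟨⟨c, hc, hlt⟩, B, -, hB, ⟨C, -, -, -, hC, -⟩, -⟩
  have hBc : (.inr B : Node G) = c := by
    simpa [hc] using mem_centroids_of_isCentralCentroid ((hB _).2 rfl)
  subst hBc
  have hle : setWeight (weight G) (subtreeVerts (blockTree G) (.inr B) C) ≤
      hs (blockTree G) (weight G) (.inr B) := by
    obtain ⟨y, hy, rfl⟩ := exists_subtreeVerts_eq C
    rw [subtreeVerts_mk]
    exact setWeight_branch_le_hs hy
  have : (n / 2 : ℚ) ≤ hs (blockTree G) (weight G) (.inr B) := hC ▸ by exact_mod_cast hle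
  linarith

/-- The two halves at the central block come from two halving edges, whose far ends are both
centroids. With only one centroid besides the block, the two components would coincide. -/
theorem not_twoCentroids_and_zeroWeightCentralBlock [Finite V] (hG : G.Connected)
    (hn : Nat.card V = n) :
    ¬ (TwoCentroids G n ∧ ZeroWeightCentralBlock G n) := by
  have hT := blockTree_isTree hG
  have hw : setWeight (weight G) Set.univ = n := (setWeight_univ_weight hG).trans hn
  rintro ⟨⟨v, B, -, hvB, -⟩, B', -, hB', ⟨C₁, C₂, hne, -, hC₁, hC₂⟩, -⟩
  have hBB : (.inr B' : Node G) = .inr B := by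
    have := mem_centroids_of_isCentralCentroid ((hB' _).2 rfl)
    rw [hvB] at this
    exact this.resolve_left Sum.inr_ne_inl
  have hnbr : ∀ u, (blockTree G).Adj (.inr B') u →
      2 * setWeight (weight G) (branch (blockTree G) (.inr B') u) = n → u = .inl v := by
    intro u hu huh
    have := mem_centroids_of_half hT hw hu.symm (half_comm hT hw hu huh)
    rw [hvB] at this
    exact this.resolve_right fun h => hu.ne (hBB.trans h.symm)
  obtain ⟨u₁, hu₁, rfl, h₁⟩ := exists_adj_half hT.connected C₁ hC₁
  obtain ⟨u₂, hu₂, rfl, h₂⟩ := exists_adj_half hT.connected C₂ hC₂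
  obtain rfl := hnbr u₁ hu₁ h₁
  obtain rfl := hnbr u₂ hu₂ h₂
  exact hne rfl

end Blocks

end BlockTree

theorem mainTheorem9 {V : Type*} [Finite V] (G : SimpleGraph V) (hG : G.Connected)
    (n : ℕ) (hn : Nat.card V = n) :
    (BlockTree.OneCentroid G n ∨ BlockTree.TwoCentroids G n ∨
      BlockTree.ZeroWeightCentralBlock G n) ∧
    ¬ (BlockTree.OneCentroid G n ∧ BlockTree.TwoCentroids G n) ∧
    ¬ (BlockTree.OneCentroid G n ∧ BlockTree.ZeroWeightCentralBlock G n) ∧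
    ¬ (BlockTree.TwoCentroids G n ∧ BlockTree.ZeroWeightCentralBlock G n) :=
  ⟨BlockTree.oneCentroid_or_twoCentroids_or_zeroWeightCentralBlock hG hn,
    BlockTree.not_oneCentroid_and_twoCentroids,
    BlockTree.not_oneCentroid_and_zeroWeightCentralBlock,
    BlockTree.not_twoCentroids_and_zeroWeightCentralBlock hG hn⟩
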